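/- Let $N>0$ be real and let $L\ge 2$ be an integer. For $n\ge 1$, a set $\mathcal C\subseteq\mathbb R^n$ is an $(N,L-1)$-multiple packing if every closed Euclidean ball of radius $\sqrt{nN}$ in $\mathbb R^n$ contains at most $L-1$ points of $\mathcal C$. For each $n$ let $\mathcal A_n\subset\mathbb R^n$ be an arbitrary centrally symmetric ($\mathcal A_n=-\mathcal A_n$), connected, compact set with nonempty interior (for example the closed unit ball or the cube $[-1,1]^n$), and define the rate of $\mathcal C\subseteq\mathbb R^n$ by $$R(\mathcal C)=\limsup_{K\to\infty}\frac1n\ln\frac{|\mathcal C\cap K\mathcal A_n|}{\operatorname{vol}(K\mathcal A_n)}\in[-\infty,+\infty],\qquad \ln 0=-\infty,$$ where $|\cdot|$ is the number of points and $\operatorname{vol}$ is Lebesgue measure. Let $$C_{L-1}(N)=\limsup_{n\to\infty}\ \sup\{R(\mathcal C):\ \mathcal C\subseteq\mathbb R^n\text{ is an }(N,L-1)\text{-multiple packing}\}$$ be the $(N,L-1)$-list-decoding capacity (multiple packing density). Then, for every choice of the sets $\mathcal A_n$, $$C_{L-1}(N)\le\frac12\ln\frac{L-1}{L\cdot 2\pi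 e N}.$$ -/

import Mathlib

open MeasureTheory Filter
open scoped Pointwise ENNReal

/-- `C ⊆ ℝⁿ` is an `(N, L-1)`-multiple packing (an `(N, L-1)`-list-decodable code): every closed
Euclidean ball of radius `√(nN)` contains at most `L - 1` points of `C`. -/
def IsMultiplePacking {n : ℕ} (N : ℝ) (L : ℕ) (C : Set (EuclideanSpace ℝ (Fin n))) : Prop :=
  ∀ y : EuclideanSpace ℝ (Fin n),
    (C ∩ Metric.closedBall y (Real.sqrt (n * N))).encard ≤ ((L - 1 : ℕ) : ℕ∞)

/-- The admissible sets `A` whose dilates `K • A` are used as observation windows: centrally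
symmetric, connected, compact, with nonempty interior. -/
structure IsWindow {n : ℕ} (A : Set (EuclideanSpace ℝ (Fin n))) : Prop where
  symm : ∀ x ∈ A, -x ∈ A
  connected : IsConnected A
  compact : IsCompact A
  interior_nonempty : (interior A).Nonempty

/-- The rate (normalized logarithmic density) of `C ⊆ ℝⁿ` measured with the window `A`:
`limsup_{K → ∞} (1/n) ln (|C ∩ K A| / |K A|)`, as an extended real number (`ln 0 = -∞`). -/
noncomputable def packingRate {n : ℕ} (A C : Set (EuclideanSpace ℝ (Fin n))) : EReal :=
  limsup (fun K : ℝ =>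
    ENNReal.log (((C ∩ K • A).encard : ℝ≥0∞) / volume (K • A)) / (n : EReal)) atTop

/-- The `(N, L-1)`-list-decoding capacity (multiple packing density)
`C_{L-1}(N) = limsup_{n → ∞} sup_C R(C)`, where `C` ranges over the `(N, L-1)`-multiple packings
in `ℝⁿ` and rates in `ℝⁿ` are measured with the window `A n`. -/
noncomputable def listDecodingCapacity
    (A : ∀ n : ℕ, Set (EuclideanSpace ℝ (Fin n))) (N : ℝ) (L : ℕ) : EReal :=
  limsup (fun n : ℕ =>
    ⨆ C : Set (EuclideanSpace ℝ (Fin n)), ⨆ _ : IsMultiplePacking N L C,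
      packingRate (A n) C) atTop

/-! A ball of radius `ρ`, with `ρ²` slightly below `nN L/(L-1)`, holds at most `M` points of the
packing, with `M` independent of `n`. Otherwise Ramsey, with quantized squared distances as colours,
yields a large nearly equidistant subset. By Plotkin's argument its squared distances are at most
about `2ρ²`, so any `L` of its points lie, like a regular simplex, within about `ρ √((L-1)/L)` of
their centroid, and hence in a forbidden ball (`exists_card_bound_of_closedBall`). Averaging over
ball centres then bounds the density by `2M / vol(B_ρ)` (`packingRate_le`). The constant `2M` does
not affect the exponent, Stirling evaluates the ball volume, and letting the slack `ε` tend to `0`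
finishes. -/

/-! ### Ramsey theory -/

/-- Multicolour Ramsey theorem for graphs, with a separate target size for each colour. -/
theorem exists_ramsey_bound_of_targets {κ : Type*} [Fintype κ] [DecidableEq κ] (n : ℕ) :
    ∀ m : κ → ℕ, ∑ a, m a = n → ∃ R : ℕ, ∀ (α : Type) [DecidableEq α] (c : α → α → κ),
      (∀ x y, c x y = c y x) → ∀ S : Finset α, R ≤ S.card →
        ∃ a, ∃ T ⊆ S, T.card = m a ∧ ∀ x ∈ T, ∀ y ∈ T, x ≠ y → c x y = a := by
  induction n with
  | zero =>
    intro m hm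
    -- One point is required because it supplies a colour.
    refine ⟨1, fun α _ c _ S hS => ?_⟩
    obtain ⟨x, -⟩ := Finset.card_pos.mp hS
    refine ⟨c x x, ∅, Finset.empty_subset _, ?_, by simp⟩
    rw [Finset.card_empty]
    exact (Finset.sum_eq_zero_iff.mp hm _ (Finset.mem_univ _)).symm
  | succ n ih =>
    intro m hm
    by_cases h0 : ∃ a, m a = 0
    · obtain ⟨a, ha⟩ := h0
      exact ⟨0, fun α _ c _ S _ => ⟨a, ∅, Finset.empty_subset _, by simp [ha], by simp⟩⟩
    push Not at h0
    have hdec : ∀ a, ∑ b, Function.update m a (m a - 1) b = n := by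
      intro a
      have h1 := Finset.sum_update_of_mem (Finset.mem_univ a) m (m a - 1)
      have h2 := Finset.add_sum_erase Finset.univ m (Finset.mem_univ a)
      rw [Finset.erase_eq] at h2
      have := h0 a
      omega
    choose R hR using fun a => ih _ (hdec a)
    -- Fix a vertex `x` and sort the others by the colour of their edge to `x`; some class `a` has
    -- at least `R a` elements.
    refine ⟨∑ a, R a + 1, fun α _ c hc S hS => ?_⟩
    obtain ⟨x, hx⟩ := Finset.card_pos.mp (lt_of_lt_of_le (Nat.succ_pos _) hS)
    have hcard : ∑ a, R a ≤ ∑ a, ((S.erase x).filter (fun y => c x y = a)).card := by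
      rw [← Finset.card_eq_sum_card_fiberwise (fun _ _ => Finset.mem_coe.mpr (Finset.mem_univ _)),
        Finset.card_erase_of_mem hx]
      omega
    obtain ⟨a, -, ha⟩ := Finset.exists_le_of_sum_le ⟨c x x, Finset.mem_univ _⟩ hcard
    obtain ⟨b, T, hTS, hT, hcol⟩ := hR a α c hc _ ha
    have hTx : ∀ y ∈ T, (y ≠ x ∧ y ∈ S) ∧ c x y = a := fun y hy => by
      simpa using hTS hy
    by_cases hba : b = a
    · subst hba
      refine ⟨b, insert x T, ?_, ?_, ?_⟩
      · exact Finset.insert_subset hx fun y hy => (hTx y hy).1.2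
      · rw [Finset.card_insert_of_notMem fun h => (hTx x h).1.1 rfl, hT, Function.update_self]
        have := h0 b
        omega
      · intro y hy z hz hyz
        rcases Finset.mem_insert.mp hy with hyx | hyT
        · rcases Finset.mem_insert.mp hz with hzx | hzT
          · exact absurd (hyx.trans hzx.symm) hyz
          · rw [hyx]; exact (hTx z hzT).2
        · rcases Finset.mem_insert.mp hz with hzx | hzT
          · rw [hzx, hc]; exact (hTx y hyT).2
          · exact hcol y hyT z hzT hyz
    · exact ⟨b, T, fun y hy => (hTx y hy).1.2, by rw [hT, Function.update_of_ne hba], hcol⟩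

/-- Multicolour Ramsey theorem for graphs. -/
theorem exists_ramsey_bound (κ : Type*) [Fintype κ] [DecidableEq κ] (m : ℕ) :
    ∃ R : ℕ, ∀ (α : Type) [DecidableEq α] (c : α → α → κ),
      (∀ x y, c x y = c y x) → ∀ S : Finset α, R ≤ S.card →
        ∃ a, ∃ T ⊆ S, T.card = m ∧ ∀ x ∈ T, ∀ y ∈ T, x ≠ y → c x y = a :=
  exists_ramsey_bound_of_targets _ (fun _ => m) rfl

/-! ### Geometry of nearly equidistant sets -/

section InnerProductSpace

variable {E : Type*} [NormedAddCommGroup E] [InnerProductSpace ℝ E]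

/-- Polarization of each inner product. Nonnegativity of the left side gives the Plotkin bound; with
`v y = x - y` the identity measures the distance from `x` to the centroid. -/
theorem norm_sum_sq_eq_card_mul_sub {ι : Type*} (T : Finset ι) (v : ι → E) :
    ‖∑ i ∈ T, v i‖ ^ 2 =
      T.card * ∑ i ∈ T, ‖v i‖ ^ 2 - 1 / 2 * ∑ i ∈ T, ∑ j ∈ T, ‖v i - v j‖ ^ 2 := by
  have h : ∑ i ∈ T, ∑ j ∈ T, ‖v i - v j‖ ^ 2 =
      ∑ i ∈ T, ∑ j ∈ T, (‖v i‖ ^ 2 + ‖v j‖ ^ 2 - 2 * inner ℝ (v i) (v j)) := by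
    refine Finset.sum_congr rfl fun i _ => Finset.sum_congr rfl fun j _ => ?_
    rw [norm_sub_sq_real]; ring
  rw [h, ← real_inner_self_eq_norm_sq, sum_inner]
  simp only [inner_sum, Finset.sum_add_distrib, Finset.sum_sub_distrib, Finset.sum_const,
    nsmul_eq_mul, ← Finset.mul_sum]
  ring

theorem card_mul_card_sub_one_mul_le_sum_dist_sq {E : Type*} [NormedAddCommGroup E] {T : Finset E} {D : ℝ}
    (hD : ∀ x ∈ T, ∀ y ∈ T, x ≠ y → D ≤ ‖x - y‖ ^ 2) :
    T.card * ((T.card - 1) * D) ≤ ∑ x ∈ T, ∑ y ∈ T, ‖x - y‖ ^ 2 := by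
  classical
  rw [← nsmul_eq_mul]
  refine Finset.card_nsmul_le_sum _ _ _ fun x hx => ?_
  rw [← Finset.add_sum_erase T _ hx]
  have h := Finset.card_nsmul_le_sum (T.erase x) (fun y => ‖x - y‖ ^ 2) D fun y hy =>
    hD x hx y (Finset.mem_of_mem_erase hy) (Finset.ne_of_mem_erase hy).symm
  have hpos : 0 < T.card := Finset.card_pos.mpr ⟨x, hx⟩
  rw [Finset.card_erase_of_mem hx, nsmul_eq_mul, Nat.cast_pred hpos] at h
  simpa using h

/-- Separated points in a ball: a Plotkin-type bound. -/
theorem card_sub_one_mul_le_of_subset_closedBall {T : Finset E} {y : E} {D ρ : ℝ}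
    (hT : T.Nonempty) (hTy : ∀ x ∈ T, dist x y ≤ ρ)
    (hD : ∀ x ∈ T, ∀ y ∈ T, x ≠ y → D ≤ ‖x - y‖ ^ 2) :
    (T.card - 1) * D ≤ 2 * T.card * ρ ^ 2 := by
  have h1 := norm_sum_sq_eq_card_mul_sub T (fun x => x - y)
  have h2 := card_mul_card_sub_one_mul_le_sum_dist_sq hD
  simp only [sub_sub_sub_cancel_right] at h1
  have h3 : ∑ x ∈ T, ‖x - y‖ ^ 2 ≤ T.card * ρ ^ 2 := by
    rw [← nsmul_eq_mul]
    refine Finset.sum_le_card_nsmul _ _ _ fun x hx => ?_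
    have := hTy x hx
    rw [dist_eq_norm] at this
    gcongr
  have hpos : (0 : ℝ) < T.card := by exact_mod_cast hT.card_pos
  have h4 := mul_le_mul_of_nonneg_left h3 hpos.le
  have h5 : (T.card : ℝ) * ((T.card - 1) * D) ≤ T.card * (2 * T.card * ρ ^ 2) := by
    nlinarith [sq_nonneg ‖∑ x ∈ T, (x - y)‖]
  exact le_of_mul_le_mul_left h5 hpos

/-- A nearly equidistant set has the circumradius of a regular simplex, approximately. -/
theorem norm_sub_centroid_sq_le {T : Finset E} {D D' : ℝ}
    (hD : ∀ x ∈ T, ∀ y ∈ T, x ≠ y → D ≤ ‖x - y‖ ^ 2)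
    (hD' : ∀ x ∈ T, ∀ y ∈ T, x ≠ y → ‖x - y‖ ^ 2 ≤ D') {x : E} (hx : x ∈ T) :
    ‖x - (T.card : ℝ)⁻¹ • ∑ y ∈ T, y‖ ^ 2 ≤ (T.card - 1) / T.card * (D' - D / 2) := by
  classical
  have hpos : 0 < T.card := Finset.card_pos.mpr ⟨x, hx⟩
  have hpos' : (0 : ℝ) < T.card := by exact_mod_cast hpos
  have h1 := norm_sum_sq_eq_card_mul_sub T (fun y => x - y)
  have h2 := card_mul_card_sub_one_mul_le_sum_dist_sq hD
  simp only [sub_sub_sub_cancel_left] at h1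
  simp_rw [fun a b : E => norm_sub_rev b a] at h1
  have h3 : ∑ y ∈ T, ‖x - y‖ ^ 2 ≤ (T.card - 1) * D' := by
    rw [← Finset.add_sum_erase T _ hx]
    have h := Finset.sum_le_card_nsmul (T.erase x) (fun y => ‖x - y‖ ^ 2) D' fun y hy =>
      hD' x hx y (Finset.mem_of_mem_erase hy) (Finset.ne_of_mem_erase hy).symm
    rw [Finset.card_erase_of_mem hx, nsmul_eq_mul, Nat.cast_pred hpos] at h
    simpa using h
  have h4 : x - (T.card : ℝ)⁻¹ • ∑ y ∈ T, y = (T.card : ℝ)⁻¹ • ∑ y ∈ T, (x - y) := by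
    rw [Finset.sum_sub_distrib, Finset.sum_const, smul_sub, ← Nat.cast_smul_eq_nsmul ℝ, smul_smul,
      inv_mul_cancel₀ hpos'.ne', one_smul]
  have h5 : ‖∑ y ∈ T, (x - y)‖ ^ 2 ≤ T.card * ((T.card - 1) * (D' - D / 2)) := by
    have := mul_le_mul_of_nonneg_left h3 hpos'.le
    linarith
  rw [h4, norm_smul, mul_pow, norm_inv, Real.norm_natCast]
  calc ((T.card : ℝ)⁻¹) ^ 2 * ‖∑ y ∈ T, (x - y)‖ ^ 2
      ≤ ((T.card : ℝ)⁻¹) ^ 2 * (T.card * ((T.card - 1) * (D' - D / 2))) := by gcongr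
    _ = (T.card - 1) / T.card * (D' - D / 2) := by field_simp

end InnerProductSpace

/-- In a ball of radius `ρ`, any sufficiently large set of points has `L` points in a ball of
radius about `ρ √(1 - 1/L)`; how large does not depend on the dimension. -/
theorem exists_card_bound_of_closedBall (L : ℕ) {ε : ℝ} (hε : 0 < ε) :
    ∃ M : ℕ, ∀ (E : Type) [NormedAddCommGroup E] [InnerProductSpace ℝ E] (ρ : ℝ), 0 < ρ →
      ∀ (y : E) (S : Finset E), (∀ x ∈ S, dist x y ≤ ρ) → M ≤ S.card →
        ∃ T ⊆ S, T.card = L ∧ ∃ z, ∀ x ∈ T,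
          dist x z ^ 2 ≤ (L - 1) / L * ((1 + ε) * ρ ^ 2) := by
  classical
  -- Half of `ε` pays for the width `δρ²` of the distance classes, half for the Plotkin factor
  -- `|T|/(|T|-1) ≤ 1 + δ`, which `m > 1/δ` ensures. Squared distances are at most `4ρ²`, so `K >
  -- 4/δ` classes suffice.
  set δ := ε / 2 with hδ
  have hδ0 : 0 < δ := by positivity
  obtain ⟨K, hK⟩ := exists_nat_gt (4 / δ)
  obtain ⟨m, hm⟩ := exists_nat_gt (1 / δ)
  obtain ⟨R, hR⟩ := exists_ramsey_bound (Fin K) (m + 1 + L)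
  refine ⟨R, fun E _ _ ρ hρ y S hSy hS => ?_⟩
  have hs : 0 < δ * ρ ^ 2 := by positivity
  have hK0 : 0 < K := by
    have : (0 : ℝ) < K := lt_trans (by positivity) hK
    exact_mod_cast this
  have hmem : ∀ x ∈ S, ∀ x' ∈ S, ⌊‖x - x'‖ ^ 2 / (δ * ρ ^ 2)⌋₊ < K := by
    intro x hx x' hx'
    rw [Nat.floor_lt (by positivity)]
    refine lt_of_le_of_lt ?_ hK
    rw [div_le_div_iff₀ hs hδ0]
    have h : ‖x - x'‖ ≤ 2 * ρ := by
      rw [← dist_eq_norm]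
      linarith [dist_triangle_right x x' y, hSy x hx, hSy x' hx']
    have : ‖x - x'‖ ^ 2 ≤ (2 * ρ) ^ 2 := by gcongr
    nlinarith
  obtain ⟨a, T, hTS, hTc, hT⟩ := hR E
    -- The reduction mod `K` only makes the colouring total; it changes nothing on `S`.
    (fun x x' => ⟨⌊‖x - x'‖ ^ 2 / (δ * ρ ^ 2)⌋₊ % K, Nat.mod_lt _ hK0⟩)
    (fun x x' => by simp only [norm_sub_rev]) S hS
  have hfl : ∀ x ∈ T, ∀ x' ∈ T, x ≠ x' → ⌊‖x - x'‖ ^ 2 / (δ * ρ ^ 2)⌋₊ = a := by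
    intro x hx x' hx' hne
    have := congrArg Fin.val (hT x hx x' hx' hne)
    rwa [Fin.val_mk, Nat.mod_eq_of_lt (hmem x (hTS hx) x' (hTS hx'))] at this
  have hlo : ∀ x ∈ T, ∀ x' ∈ T, x ≠ x' → a * (δ * ρ ^ 2) ≤ ‖x - x'‖ ^ 2 := by
    intro x hx x' hx' hne
    rw [← le_div_iff₀ hs, ← hfl x hx x' hx' hne]
    exact Nat.floor_le (by positivity)
  have hhi : ∀ x ∈ T, ∀ x' ∈ T, x ≠ x' → ‖x - x'‖ ^ 2 ≤ (a + 1) * (δ * ρ ^ 2) := by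
    intro x hx x' hx' hne
    rw [← div_le_iff₀ hs, ← hfl x hx x' hx' hne]
    exact (Nat.lt_floor_add_one _).le
  have hTne : T.Nonempty := Finset.card_pos.mp (by omega)
  have hP := card_sub_one_mul_le_of_subset_closedBall hTne (fun x hx => hSy x (hTS hx)) hlo
  obtain ⟨U, hUT, hUc⟩ := Finset.exists_subset_card_eq (show L ≤ T.card by omega)
  refine ⟨U, hUT.trans hTS, hUc, (U.card : ℝ)⁻¹ • ∑ x ∈ U, x, fun x hx => ?_⟩
  have hL : (1 : ℝ) ≤ L := by
    rw [← hUc]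
    exact_mod_cast Finset.card_pos.mpr ⟨x, hx⟩
  have h := norm_sub_centroid_sq_le (fun x hx y hy => hlo x (hUT hx) y (hUT hy))
    (fun x hx y hy => hhi x (hUT hx) y (hUT hy)) hx
  rw [dist_eq_norm]
  refine h.trans ?_
  rw [hUc]
  refine mul_le_mul_of_nonneg_left ?_ (div_nonneg (by linarith) (by linarith))
  have hTm : (m : ℝ) + 1 ≤ T.card := by rw [hTc]; push_cast; linarith
  rw [div_lt_iff₀ hδ0] at hm
  have h2 : 1 ≤ ((T.card : ℝ) - 1) * δ := by nlinarith
  have h3 : ((T.card : ℝ) - 1) * (a * (δ * ρ ^ 2)) ≤ ((T.card : ℝ) - 1) * (2 * (1 + δ) * ρ ^ 2) := by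
    nlinarith [sq_nonneg ρ]
  have hT1 : 0 < (T.card : ℝ) - 1 := by
    by_contra hcon
    nlinarith
  have h4 := le_of_mul_le_mul_left h3 hT1
  have : ε = 2 * δ := by rw [hδ]; ring
  rw [this]
  linarith

/-! ### From local counts to density -/

/-- Averaging: if every ball of radius `ρ` contains at most `M` points of `S`, then the number of
points of `S` is at most `M` times the volume ratio of the `ρ`-thickening of `S` to the ball. -/
theorem card_mul_volume_closedBall_le {n : ℕ} {ρ : ℝ} {M : ℕ} {W : Set (EuclideanSpace ℝ (Fin n))}
    {S : Finset (EuclideanSpace ℝ (Fin n))} (hSW : (S : Set _) ⊆ W)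
    (hM : ∀ y, ∀ T ⊆ S, (∀ x ∈ T, dist x y ≤ ρ) → T.card ≤ M) :
    S.card * volume (Metric.closedBall (0 : EuclideanSpace ℝ (Fin n)) ρ) ≤
      M * volume (Metric.cthickening ρ W) := by
  classical
  have h1 : ∀ x : EuclideanSpace ℝ (Fin n), volume (Metric.closedBall x ρ) =
      ∫⁻ y, (Metric.closedBall x ρ).indicator 1 y := fun x =>
    (lintegral_indicator_one Metric.isClosed_closedBall.measurableSet).symm
  calc (S.card : ℝ≥0∞) * volume (Metric.closedBall (0 : EuclideanSpace ℝ (Fin n)) ρ)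
      = ∑ x ∈ S, volume (Metric.closedBall x ρ) := by
        simp_rw [Measure.addHaar_closedBall_center]
        rw [Finset.sum_const, nsmul_eq_mul]
    _ = ∫⁻ y, ∑ x ∈ S, (Metric.closedBall x ρ).indicator 1 y := by
        simp_rw [h1]
        rw [lintegral_finsetSum]
        exact fun x _ => measurable_one.indicator Metric.isClosed_closedBall.measurableSet
    _ ≤ ∫⁻ y, (Metric.cthickening ρ W).indicator (fun _ => (M : ℝ≥0∞)) y := by
        refine lintegral_mono fun y => ?_
        have hsum : ∑ x ∈ S, (Metric.closedBall x ρ).indicator (1 : EuclideanSpace ℝ (Fin n) → ℝ≥0∞) y =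
            ((S.filter fun x => dist x y ≤ ρ).card : ℝ≥0∞) := by
          rw [Finset.card_filter]
          push_cast
          refine Finset.sum_congr rfl fun x _ => ?_
          simp [Set.indicator_apply, dist_comm]
        simp only [hsum]
        by_cases hy : y ∈ Metric.cthickening ρ W
        · rw [Set.indicator_of_mem hy]
          exact_mod_cast hM y _ (Finset.filter_subset _ _) fun x hx => (Finset.mem_filter.mp hx).2
        · rw [Finset.filter_eq_empty_iff.mpr]
          · simp
          · intro x hx hxy
            exact hy (Metric.mem_cthickening_of_dist_le y x ρ W (hSW hx) (by rwa [dist_comm]))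
    _ = M * volume (Metric.cthickening ρ W) := by
        rw [lintegral_indicator_const Metric.isClosed_cthickening.measurableSet]

theorem encard_mul_volume_closedBall_le {n : ℕ} {ρ : ℝ} (hρ : 0 < ρ) {M : ℕ}
    {W S : Set (EuclideanSpace ℝ (Fin n))} (hW : IsCompact W) (hSW : S ⊆ W)
    (hM : ∀ y, ∀ T : Finset (EuclideanSpace ℝ (Fin n)), (T : Set _) ⊆ S →
      (∀ x ∈ T, dist x y ≤ ρ) → T.card ≤ M) :
    (S.encard : ℝ≥0∞) * volume (Metric.closedBall (0 : EuclideanSpace ℝ (Fin n)) ρ) ≤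
      M * volume (Metric.cthickening ρ W) := by
  have key : ∀ T : Finset (EuclideanSpace ℝ (Fin n)), (T : Set _) ⊆ S →
      T.card * volume (Metric.closedBall (0 : EuclideanSpace ℝ (Fin n)) ρ) ≤
        M * volume (Metric.cthickening ρ W) := fun T hT =>
    card_mul_volume_closedBall_le (hT.trans hSW) fun y U hU =>
      hM y U ((Finset.coe_subset.mpr hU).trans hT)
  by_cases hfin : S.Finite
  · have := key hfin.toFinset (by simp)
    rwa [hfin.encard_eq_coe_toFinset_card]
  · exfalso
    have hV : volume (Metric.closedBall (0 : EuclideanSpace ℝ (Fin n)) ρ) ≠ 0 :=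
      (Metric.measure_closedBall_pos volume _ hρ).ne'
    have hV' : volume (Metric.closedBall (0 : EuclideanSpace ℝ (Fin n)) ρ) ≠ ∞ :=
      measure_closedBall_lt_top.ne
    have hR : (M * volume (Metric.cthickening ρ W)) /
        volume (Metric.closedBall (0 : EuclideanSpace ℝ (Fin n)) ρ) ≠ ∞ :=
      ENNReal.div_ne_top (ENNReal.mul_ne_top (ENNReal.natCast_ne_top M)
        hW.cthickening.measure_lt_top.ne) hV
    obtain ⟨k, hk⟩ := ENNReal.exists_nat_gt hR
    obtain ⟨T, hTS, hT⟩ := Set.Infinite.exists_subset_card_eq hfin k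
    have := key T hTS
    rw [hT, ← ENNReal.le_div_iff_mul_le (Or.inl hV) (Or.inl hV')] at this
    exact absurd hk this.not_gt

theorem volume_cthickening_smul {n : ℕ} {A : Set (EuclideanSpace ℝ (Fin n))} (hA : IsCompact A)
    {K ρ : ℝ} (hK : 0 < K) (hρ : 0 ≤ ρ) :
    volume (Metric.cthickening ρ (K • A)) =
      ENNReal.ofReal (K ^ n) * volume (Metric.cthickening (ρ / K) A) := by
  have h : Metric.cthickening ρ (K • A) = K • Metric.cthickening (ρ / K) A := by
    have hKA : IsCompact (K • A) := hA.smul K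
    rw [← hKA.add_closedBall_zero hρ,
      ← hA.add_closedBall_zero (div_nonneg hρ hK.le), smul_add,
      smul_closedBall _ _ (div_nonneg hρ hK.le), smul_zero, Real.norm_of_nonneg hK.le,
      mul_div_cancel₀ _ hK.ne']
  rw [h, Measure.addHaar_smul, finrank_euclideanSpace_fin, abs_of_nonneg (by positivity)]

/-- After rescaling by `K`, the thickening has width `ρ/K → 0`, so boundary effects vanish; any
factor above `1` would do. -/
theorem eventually_volume_cthickening_smul_le {n : ℕ} {A : Set (EuclideanSpace ℝ (Fin n))}
    (hA : IsCompact A) (hA0 : volume A ≠ 0) {ρ : ℝ} (hρ : 0 ≤ ρ) :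
    ∀ᶠ K : ℝ in atTop, volume (Metric.cthickening ρ (K • A)) ≤ 2 * volume (K • A) := by
  have ht : Tendsto (fun K : ℝ => volume (Metric.cthickening (ρ / K) A)) atTop (nhds (volume A)) :=
    (tendsto_measure_cthickening_of_isCompact hA).comp (tendsto_const_nhds.div_atTop tendsto_id)
  have hlt : volume A < 2 * volume A := by
    rw [two_mul]
    exact ENNReal.lt_add_right hA.measure_lt_top.ne hA0
  filter_upwards [ht.eventually_lt_const hlt, eventually_gt_atTop 0] with K hK hK0
  rw [volume_cthickening_smul hA hK0 hρ, Measure.addHaar_smul, finrank_euclideanSpace_fin,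
    abs_of_nonneg (by positivity), mul_left_comm]
  gcongr

theorem packingRate_le {n : ℕ} {ρ : ℝ} (hρ : 0 < ρ) {M : ℕ}
    {A C : Set (EuclideanSpace ℝ (Fin n))} (hA : IsWindow A)
    (hM : ∀ y, ∀ T : Finset (EuclideanSpace ℝ (Fin n)), (T : Set _) ⊆ C →
      (∀ x ∈ T, dist x y ≤ ρ) → T.card ≤ M) :
    packingRate A C ≤
      ENNReal.log (2 * M / volume (Metric.closedBall (0 : EuclideanSpace ℝ (Fin n)) ρ)) / (n : EReal) := by
  have hA0 : volume A ≠ 0 := fun h =>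
    (isOpen_interior.measure_pos volume hA.interior_nonempty).ne'
      (measure_mono_null interior_subset h)
  refine limsup_le_of_le (by isBoundedDefault) ?_
  filter_upwards [eventually_volume_cthickening_smul_le hA.compact hA0 hρ.le,
    eventually_gt_atTop 0] with K hK hK0
  refine EReal.div_le_div_right_of_nonneg (by positivity) (ENNReal.log_monotone ?_)
  have hKA : volume (K • A) ≠ 0 := by
    rw [Measure.addHaar_smul]
    exact mul_ne_zero (by simp [hK0.ne']) hA0
  have hKA' : volume (K • A) ≠ ∞ := (hA.compact.smul K).measure_lt_top.ne
  have hV : volume (Metric.closedBall (0 : EuclideanSpace ℝ (Fin n)) ρ) ≠ 0 :=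
    (Metric.measure_closedBall_pos volume _ hρ).ne'
  have hV' : volume (Metric.closedBall (0 : EuclideanSpace ℝ (Fin n)) ρ) ≠ ∞ :=
    measure_closedBall_lt_top.ne
  rw [ENNReal.div_le_iff hKA hKA', ENNReal.mul_div_right_comm.symm,
    ENNReal.le_div_iff_mul_le (Or.inl hV) (Or.inl hV')]
  calc _ ≤ M * volume (Metric.cthickening ρ (K • A)) :=
        encard_mul_volume_closedBall_le hρ (hA.compact.smul K) Set.inter_subset_right
          fun y T hT => hM y T (hT.trans Set.inter_subset_left)
    _ ≤ M * (2 * volume (K • A)) := by gcongr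
    _ = _ := by ring

/-! ### Asymptotics of ball volumes -/

theorem tendsto_log_factorial_div_sub_log :
    Tendsto (fun n : ℕ => Real.log n.factorial / n - Real.log n) atTop (nhds (-1)) := by
  have hpi : Real.sqrt Real.pi ≠ 0 := by positivity
  have h1 : Tendsto (fun n : ℕ => Real.log (Stirling.stirlingSeq n) / n) atTop (nhds 0) :=
    (Stirling.tendsto_stirlingSeq_sqrt_pi.log hpi).div_atTop tendsto_natCast_atTop_atTop
  have h2 : Tendsto (fun n : ℕ => Real.log n / n) atTop (nhds 0) :=
    (Real.isLittleO_log_id_atTop.tendsto_div_nhds_zero).comp tendsto_natCast_atTop_atTop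
  have h3 : Tendsto (fun n : ℕ => Real.log 2 / n) atTop (nhds 0) :=
    tendsto_const_nhds.div_atTop tendsto_natCast_atTop_atTop
  have h := ((h1.add (h2.const_mul (1 / 2))).add (h3.const_mul (1 / 2))).sub_const 1
  simp only [mul_zero, add_zero, zero_sub] at h
  refine h.congr' ?_
  filter_upwards [eventually_gt_atTop 0] with n hn
  have hn' : (0 : ℝ) < n := by exact_mod_cast hn
  rw [Stirling.log_stirlingSeq_formula, Real.log_mul two_ne_zero hn'.ne',
    Real.log_div hn'.ne' (Real.exp_pos 1).ne', Real.log_exp]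
  field_simp
  ring

/-- The duplication formula turns `Γ(s)² ≤ Γ(s) Γ(s + 1/2)`, `s = n/2 + 1`, into a factorial bound.
Monotonicity of `Γ` is used on `[2, ∞)`, whence `2 ≤ n`. -/
theorem log_Gamma_half_add_one_le {n : ℕ} (hn : 2 ≤ n) :
    Real.log (Real.Gamma (n / 2 + 1)) ≤
      1 / 2 * (Real.log n.factorial + Real.log (n + 1) - (n + 1) * Real.log 2
        + 1 / 2 * Real.log Real.pi) := by
  have hn' : (2 : ℝ) ≤ n := by exact_mod_cast hn
  have hG : 0 < Real.Gamma ((n : ℝ) / 2 + 1) := Real.Gamma_pos_of_pos (by positivity)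
  have hmono : Real.Gamma ((n : ℝ) / 2 + 1) ≤ Real.Gamma ((n : ℝ) / 2 + 1 + 1 / 2) :=
    Real.Gamma_strictMonoOn_Ici.monotoneOn (Set.mem_Ici.mpr (by linarith))
      (Set.mem_Ici.mpr (by linarith)) (by linarith)
  have hdup := Real.Gamma_mul_Gamma_add_half ((n : ℝ) / 2 + 1)
  have h2 : 2 * ((n : ℝ) / 2 + 1) = ((n + 1 : ℕ) : ℝ) + 1 := by push_cast; ring
  rw [h2, Real.Gamma_nat_eq_factorial, Nat.factorial_succ] at hdup
  have hsq : Real.Gamma ((n : ℝ) / 2 + 1) * Real.Gamma ((n : ℝ) / 2 + 1) ≤ _ :=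
    (mul_le_mul_of_nonneg_left hmono hG.le).trans_eq hdup
  have hlog := Real.log_le_log (mul_pos hG hG) hsq
  have hf : (0 : ℝ) < n.factorial := by exact_mod_cast n.factorial_pos
  push_cast at hlog
  rw [Real.log_mul hG.ne' hG.ne', Real.log_mul (by positivity) (by positivity),
    Real.log_mul (by positivity) (by positivity), Real.log_mul (by positivity) (by positivity),
    Real.log_rpow two_pos, Real.log_sqrt Real.pi_pos.le] at hlog
  linarith

/-- The exponential growth rate of the inverse volume of a ball of radius `√(n r)` in dimension
`n` is at most `-1/2 log (2 π e r)`. -/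
theorem limsup_log_div_volume_closedBall_le {M : ℕ} (hM : 0 < M) {r : ℝ} (hr : 0 < r) :
    limsup (fun n : ℕ => ENNReal.log (2 * M / volume (Metric.closedBall
      (0 : EuclideanSpace ℝ (Fin n)) (Real.sqrt (n * r)))) / (n : EReal)) atTop ≤
      ((-(1 / 2) * Real.log (2 * Real.pi * Real.exp 1 * r) : ℝ) : EReal) := by
  set u : ℕ → ℝ := fun n => 1 / 2 * (Real.log n.factorial / n - Real.log n)
    + 1 / 2 * (Real.log (n + 1) / n)
    + (Real.log (2 * M) - 1 / 2 * Real.log 2 + 1 / 4 * Real.log Real.pi) / n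
    - 1 / 2 * (Real.log 2 + Real.log Real.pi + Real.log r) with hu
  have hcast : Tendsto (fun n : ℕ => (n : ℝ)) atTop atTop := tendsto_natCast_atTop_atTop
  have h1 : Tendsto (fun n : ℕ => Real.log (n + 1) / n) atTop (nhds 0) := by
    have h := (Real.isLittleO_log_id_atTop.tendsto_div_nhds_zero).comp
      (hcast.comp (tendsto_add_atTop_nat 1))
    have h' : Tendsto (fun n : ℕ => ((n : ℝ) + 1) / n) atTop (nhds 1) := by
      have := (tendsto_const_nhds (x := (1 : ℝ))).div_atTop hcast |>.const_add 1
      rw [add_zero] at this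
      refine this.congr' ?_
      filter_upwards [eventually_gt_atTop 0] with n hn
      have hn' : (0 : ℝ) < n := by exact_mod_cast hn
      field_simp
    have := h.mul h'
    rw [zero_mul] at this
    refine this.congr' ?_
    filter_upwards [eventually_gt_atTop 0] with n hn
    have hn' : (0 : ℝ) < n := by exact_mod_cast hn
    simp only [Function.comp_apply, id_eq]
    push_cast
    field_simp
  have hlim : Tendsto u atTop (nhds (-(1 / 2) * Real.log (2 * Real.pi * Real.exp 1 * r))) := by
    have h := ((((tendsto_log_factorial_div_sub_log).const_mul (1 / 2)).add
      (h1.const_mul (1 / 2))).add ((tendsto_const_nhds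
        (x := Real.log (2 * M) - 1 / 2 * Real.log 2 + 1 / 4 * Real.log Real.pi)).div_atTop
          hcast)).sub_const (1 / 2 * (Real.log 2 + Real.log Real.pi + Real.log r))
    convert h using 2
    rw [Real.log_mul (by positivity) hr.ne', Real.log_mul (by positivity) (by positivity),
      Real.log_mul two_ne_zero (by positivity), Real.log_exp]
    ring
  refine (limsup_le_limsup ?_ (by isBoundedDefault) (by isBoundedDefault)).trans_eq
    ((continuous_coe_real_ereal.tendsto _).comp hlim).limsup_eq
  filter_upwards [eventually_ge_atTop 2] with n hn
  have hn' : (0 : ℝ) < n := by exact_mod_cast lt_of_lt_of_le two_pos hn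
  have : Nonempty (Fin n) := ⟨⟨0, by omega⟩⟩
  have hG : 0 < Real.Gamma ((n : ℝ) / 2 + 1) := Real.Gamma_pos_of_pos (by positivity)
  have hM' : (0 : ℝ) < M := by exact_mod_cast hM
  have hv : 0 < Real.sqrt (n * r) ^ n * (Real.sqrt Real.pi ^ n / Real.Gamma (n / 2 + 1)) := by
    positivity
  have hE : 2 * (M : ℝ≥0∞) / volume (Metric.closedBall (0 : EuclideanSpace ℝ (Fin n))
      (Real.sqrt (n * r))) = ENNReal.ofReal (2 * M /
        (Real.sqrt (n * r) ^ n * (Real.sqrt Real.pi ^ n / Real.Gamma (n / 2 + 1)))) := by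
    rw [EuclideanSpace.volume_closedBall, Fintype.card_fin,
      ← ENNReal.ofReal_pow (Real.sqrt_nonneg _), ← ENNReal.ofReal_mul (by positivity),
      ENNReal.ofReal_div_of_pos hv, ENNReal.ofReal_mul two_pos.le, ENNReal.ofReal_ofNat,
      ENNReal.ofReal_natCast]
  rw [hE, ENNReal.log_ofReal_of_pos (by positivity)]
  have hcoe : ((n : ℕ) : EReal) = (((n : ℝ)) : EReal) := by norm_cast
  rw [hcoe, ← EReal.coe_div, Function.comp_apply, EReal.coe_le_coe_iff, div_le_iff₀ hn']
  rw [Real.log_div (by positivity) hv.ne',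
    Real.log_mul (x := Real.sqrt (n * r) ^ n) (by positivity) (by positivity),
    Real.log_div (by positivity) hG.ne', Real.log_pow, Real.log_pow, Real.log_sqrt (by positivity),
    Real.log_sqrt Real.pi_pos.le, Real.log_mul hn'.ne' hr.ne']
  have hΓ := log_Gamma_half_add_one_le hn
  have hun : u n * n = 1 / 2 * (Real.log n.factorial - n * Real.log n)
      + 1 / 2 * Real.log (n + 1)
      + (Real.log (2 * M) - 1 / 2 * Real.log 2 + 1 / 4 * Real.log Real.pi)
      - n * (1 / 2 * (Real.log 2 + Real.log Real.pi + Real.log r)) := by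
    simp only [hu]
    field_simp
  rw [hun]
  linarith

/-! ### The capacity bound -/

/-- A multiple packing has boundedly many points in any ball whose radius is slightly below
`√(L / (L - 1))` times the packing radius. -/
theorem IsMultiplePacking.exists_card_le {N : ℝ} (hN : 0 < N) {L : ℕ} (hL : 2 ≤ L) {ε : ℝ}
    (hε : 0 < ε) : ∃ M : ℕ, 0 < M ∧ ∀ n : ℕ, 0 < n → ∀ C : Set (EuclideanSpace ℝ (Fin n)),
      IsMultiplePacking N L C → ∀ y, ∀ T : Finset (EuclideanSpace ℝ (Fin n)), (T : Set _) ⊆ C →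
        (∀ x ∈ T, dist x y ≤ Real.sqrt (n * (N * L / ((L - 1) * (1 + ε))))) → T.card ≤ M := by
  obtain ⟨M, hM⟩ := exists_card_bound_of_closedBall L hε
  have hL' : (2 : ℝ) ≤ L := by exact_mod_cast hL
  have hL1 : (0 : ℝ) < (L : ℝ) - 1 := by linarith
  refine ⟨M + 1, Nat.succ_pos _, fun n hn C hC y T hTC hT => ?_⟩
  have hn' : (0 : ℝ) < n := by exact_mod_cast hn
  have hr : 0 < n * (N * L / ((L - 1) * (1 + ε))) := by positivity
  by_contra hcon
  obtain ⟨U, hUT, hUc, z, hz⟩ := hM _ _ (Real.sqrt_pos.mpr hr) y T hT (by omega)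
  -- The radius is chosen so that `(L-1)/L · (1+ε)` times its square is exactly `nN`.
  have hsub : (U : Set _) ⊆ C ∩ Metric.closedBall z (Real.sqrt (n * N)) := by
    intro x hx
    refine ⟨hTC (hUT hx), ?_⟩
    rw [Metric.mem_closedBall]
    refine Real.le_sqrt_of_sq_le ((hz x hx).trans_eq ?_)
    rw [Real.sq_sqrt hr.le]
    field_simp
  have h := (Set.encard_le_encard hsub).trans (hC z)
  rw [Set.encard_coe_eq_coe_finsetCard, hUc] at h
  have : L ≤ L - 1 := by exact_mod_cast h
  omega

theorem listDecodingCapacity_le_add {N : ℝ} (hN : 0 < N) {L : ℕ} (hL : 2 ≤ L)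
    {A : ∀ n : ℕ, Set (EuclideanSpace ℝ (Fin n))} (hA : ∀ n : ℕ, IsWindow (A n)) {ε : ℝ}
    (hε : 0 < ε) :
    listDecodingCapacity A N L ≤
      ((1 / 2 * Real.log (((L : ℝ) - 1) / (L * (2 * Real.pi * Real.exp 1 * N)))
        + 1 / 2 * Real.log (1 + ε) : ℝ) : EReal) := by
  obtain ⟨M, hM0, hM⟩ := IsMultiplePacking.exists_card_le hN hL hε
  have hL' : (2 : ℝ) ≤ L := by exact_mod_cast hL
  have hL1 : (0 : ℝ) < (L : ℝ) - 1 := by linarith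
  have hr : 0 < N * L / ((L - 1) * (1 + ε)) := by positivity
  calc listDecodingCapacity A N L
      ≤ limsup (fun n : ℕ => ENNReal.log (2 * M / volume (Metric.closedBall
          (0 : EuclideanSpace ℝ (Fin n)) (Real.sqrt (n * (N * L / ((L - 1) * (1 + ε)))))))
            / (n : EReal)) atTop := by
        refine limsup_le_limsup ?_ (by isBoundedDefault) (by isBoundedDefault)
        filter_upwards [eventually_gt_atTop 0] with n hn
        have hn' : (0 : ℝ) < n := by exact_mod_cast hn
        exact iSup₂_le fun C hC =>
          packingRate_le (Real.sqrt_pos.mpr (mul_pos hn' hr)) (hA n) (hM n hn C hC)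
    _ ≤ _ := limsup_log_div_volume_closedBall_le hM0 hr
    _ = _ := by
        congr 1
        rw [show 2 * Real.pi * Real.exp 1 * (N * L / ((L - 1) * (1 + ε))) =
          ((((L : ℝ) - 1) / (L * (2 * Real.pi * Real.exp 1 * N))) * (1 + ε))⁻¹ by field_simp,
          Real.log_inv, Real.log_mul (by positivity) (by positivity)]
        ring

theorem mainTheorem6 (N : ℝ) (hN : 0 < N) (L : ℕ) (hL : 2 ≤ L)
    (A : ∀ n : ℕ, Set (EuclideanSpace ℝ (Fin n))) (hA : ∀ n : ℕ, IsWindow (A n)) :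
    listDecodingCapacity A N L ≤
      ((1 / 2 * Real.log (((L : ℝ) - 1) / (L * (2 * Real.pi * Real.exp 1 * N))) : ℝ) : EReal) := by
  set a := 1 / 2 * Real.log (((L : ℝ) - 1) / (L * (2 * Real.pi * Real.exp 1 * N)))
  have hlim : Tendsto (fun ε : ℝ => a + 1 / 2 * Real.log (1 + ε)) (nhdsWithin 0 (Set.Ioi 0))
      (nhds a) := by
    have h : ContinuousAt (fun ε : ℝ => a + 1 / 2 * Real.log (1 + ε)) 0 := by
      refine continuousAt_const.add (continuousAt_const.mul (ContinuousAt.log ?_ (by norm_num)))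
      fun_prop
    simpa using h.tendsto.mono_left nhdsWithin_le_nhds
  refine ge_of_tendsto ((continuous_coe_real_ereal.tendsto a).comp hlim) ?_
  filter_upwards [self_mem_nhdsWithin] with ε hε
  exact listDecodingCapacity_le_add hN hL hA hε
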